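/- Consider a network congestion game with a finite set of agents, a graph with $m$ edges, a finite set $\mathcal K$ of origin-destination pairs, for each $k\in\mathcal K$ a finite nonempty set $\mathcal R_k$ of routes (paths from the origin to the destination of $k$), $n_k\ge 0$ agents with pair $k$, and affine edge costs $\mathbf c(\mathbf f)=\Lambda\mathbf f+\mathbf b$, $\Lambda\in\mathbb R^{m\times m}$, $\mathbf b\in\mathbb R^m$. Let $D=[\delta_{er}]$ be the edge-route incidence matrix over all routes of all pairs, $\mathbf n=(n_k)_{k\in\mathcal K}$, and $\mathcal F=\mathbb R_{\ge 0}^m$. Let $\Sigma_0,\Sigma_s\in\mathbb R^{m\times m}$ (covariances of the receivers' priors and of the signal) be symmetric positive definite, let $\Sigma_h$ be symmetric positive semidefinite and $\mu_h\in\mathbb R^m$ (covariance and mean of the law from which the receivers' prior means are drawn). Put $$\Sigma=(\Sigma_s^{-1}+\Sigma_0^{-1})^{-1},\quad \Sigma_1=\Sigma+\Sigma(\Sigma\Sigma_s^{-1})^T,\quad \bar\Sigma=\Sigma_1+(\Sigma\Sigma_0^{-1})\Sigma_h(\Sigma\Sigma_0^{-1})^T,$$ and for $\mu_s\in\mathbb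 R^m$ $$\bar\mu=\Sigma\Sigma_s^{-1}\mu_s+\Sigma\Sigma_0^{-1}\mu_h,\quad \mu_\phi=(\Lambda\bar\mu+\mathbf b)D,\quad \Sigma_\phi=D^T(\Lambda\bar\Sigma\Lambda^T)D.$$ For a route $r\in\mathcal R_k$ let $B_{rk}$ be the matrix with one row for each route $r'\in\mathcal R_k$, $r'\ne r$, which has the entry $1$ in column $r$, $-1$ in column $r'$ and $0$ elsewhere; put $\mu_{rk}=B_{rk}\mu_\phi$ and $\Sigma_{rk}=B_{rk}\Sigma_\phi B_{rk}^T$. Let $cdf(\mathbf y;\mu,S)$ be the probability that a random vector with the Gaussian law $N(\mu,S)$ is coordinatewise at most $\mathbf y$ (it is $1$ in dimension $0$), and let $[cdf(\mathbf 0;\mu_{rk},\Sigma_{rk})]$ be the matrix with rows indexed by routes $r$ and columns by pairs $k$, with entry $0$ where $r\notin\mathcal R_k$. Define $$g(\mu_s)=D\,[cdf(\mathbf 0;\mu_{rk},\Sigma_{rk})]\,\mathbf n .$$ Then $g$ maps $\mathcal F$ into itself, and it maps the set $\{D\mathbf h: 0\le h_r\le n_k \text{ for all } k \text{ and } r\in\mathcal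 R_k\}$ into itself. There is a $\mu_{s0}\in\mathcal F$, which also lies in the latter set, with $\mu_{s0}=g(\mu_{s0})$. For this $\mu_{s0}$ the Gaussian signal $\mathbf s\sim N(\mu_{s0},\Sigma_s)$ is self-fulfilling: $N(\mu_{s0},\Sigma_s)=N(\hat{\mathbf f},\Sigma_s)$, where $\hat{\mathbf f}=D\hat{\mathbf h}$ is the outcome flow that it induces, $\hat h_r=n_k\,P(\phi_r\le\phi_{r'}\text{ for all } r'\in\mathcal R_k)$ for $r\in\mathcal R_k$, with route costs $\phi\sim N(\mu_\phi,\Sigma_\phi)$. -/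

import Mathlib

open MeasureTheory ProbabilityTheory
open scoped Matrix

noncomputable section

/-- A (multi)graph with vertices `V` and edges `E`. An edge may be used from `tail e` to `head e`,
and also backwards when `twoWay e` holds: directed, undirected and mixed graphs are covered. -/
structure Network (V E : Type*) where
  tail : E → V
  head : E → V
  twoWay : E → Prop

namespace Network

variable {V E : Type*} (G : Network V E)

/-- The edge `e` leads from `u` to `v`. -/
def Link (e : E) (u v : V) : Prop :=
  (u = G.tail e ∧ v = G.head e) ∨ (G.twoWay e ∧ u = G.head e ∧ v = G.tail e)

/-- `G.Walk o l vs d`: the list of edges `l` is a walk from `o` to `d` that visits the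
vertices `vs`, in this order. -/
inductive Walk : V → List E → List V → V → Prop
  | nil (o : V) : Walk o [] [o] o
  | cons {o v d : V} {e : E} {l : List E} {vs : List V} (he : G.Link e o v)
      (hl : Walk v l vs d) : Walk o (e :: l) (o :: vs) d

/-- The list of edges `l` is a path (no vertex is visited twice) from `o` to `d`. -/
def IsPath (o : V) (l : List E) (d : V) : Prop :=
  ∃ vs : List V, G.Walk o l vs d ∧ vs.Nodup

end Network

/-- Atomic unweighted network congestion game with agents `N`: a network, a finite set `OD` of
origin-destination pairs, for each pair `k` a finite nonempty set `routes k` of paths from its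
origin to its destination, the pair of each agent, and the affine edge costs `c(f) = Λ f + b`. -/
structure CongestionGame (V E N : Type*) extends Network V E where
  OD : Finset (V × V)
  routes : OD → Finset (List E)
  routes_nonempty : ∀ k, (routes k).Nonempty
  routes_isPath : ∀ k, ∀ l ∈ routes k, toNetwork.IsPath k.1.1 l k.1.2
  pair : N → OD
  Λ : Matrix E E ℝ
  b : E → ℝ

/-- The Gaussian parameters: receiver `i` has the prior belief `N(μ₀ᵢ, Σ₀)` on the edge flow,
the prior means `μ₀ᵢ` are drawn from `N(μh, Σh)`, and the signal has covariance `Σs`.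
The matrices `Σ₀`, `Σh`, `Σs` are the fields `S₀`, `Sh`, `Ss`. -/
structure GaussianParams (E : Type*) where
  S₀ : Matrix E E ℝ
  μh : E → ℝ
  Sh : Matrix E E ℝ
  Ss : Matrix E E ℝ

/-- The Gaussian law with mean `μ` and covariance `S`. -/
def gaussianLaw {ι : Type*} [Fintype ι] [DecidableEq ι] (μ : ι → ℝ) (S : Matrix ι ι ℝ) :
    Measure (EuclideanSpace ℝ ι) :=
  multivariateGaussian (WithLp.toLp 2 μ) S

/-- Multivariate normal cumulative distribution function `cdf(y; μ, S)`. -/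
def normalCdf {ι : Type*} [Fintype ι] [DecidableEq ι] (y μ : ι → ℝ) (S : Matrix ι ι ℝ) : ℝ :=
  (gaussianLaw μ S).real {x | ∀ j, x j ≤ y j}

namespace GaussianParams

variable {E : Type*} [Fintype E] [DecidableEq E] (P : GaussianParams E)

/-- Posterior covariance `Σ = (Σs⁻¹ + Σ₀⁻¹)⁻¹`. -/
def postCov : Matrix E E ℝ := (P.Ss⁻¹ + P.S₀⁻¹)⁻¹

/-- `Σ₁ = Σ + Σ (Σ Σs⁻¹)ᵀ`. -/
def cov₁ : Matrix E E ℝ := P.postCov + P.postCov * (P.postCov * P.Ss⁻¹)ᵀ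

/-- `Σ̄ = Σ₁ + (Σ Σ₀⁻¹) Σh (Σ Σ₀⁻¹)ᵀ`. -/
def covBar : Matrix E E ℝ :=
  P.cov₁ + (P.postCov * P.S₀⁻¹) * P.Sh * (P.postCov * P.S₀⁻¹)ᵀ

/-- `μ̄ = Σ Σs⁻¹ μs + Σ Σ₀⁻¹ μh`. -/
def meanBar (μs : E → ℝ) : E → ℝ :=
  (P.postCov * P.Ss⁻¹) *ᵥ μs + (P.postCov * P.S₀⁻¹) *ᵥ P.μh

/-- The signal actually sent, `p(s) = N(s; μs, Σs)`. -/
def signalLaw (μs : E → ℝ) : Measure (EuclideanSpace ℝ E) := gaussianLaw μs P.Ss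

/-- The committed signal distribution given the edge flow, `π(s | f) = N(s; f, Σs)`. -/
def commitment (f : E → ℝ) : Measure (EuclideanSpace ℝ E) := gaussianLaw f P.Ss

end GaussianParams

namespace CongestionGame

variable {V E N : Type*} [Fintype E] [DecidableEq V] [DecidableEq E] [Fintype N]
  (G : CongestionGame V E N) (P : GaussianParams E)

/-- The set of all routes; a route remembers its origin-destination pair `r.1`. -/
abbrev Route : Type _ := Σ k : G.OD, G.routes k

/-- `n_k`, the number of agents whose pair is `k`. -/
def numAgents (k : G.OD) : ℝ := ((Finset.univ.filter fun i => G.pair i = k).card : ℝ)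

/-- Edge-route incidence matrix. -/
def D : Matrix E G.Route ℝ := fun e r => if e ∈ r.2.1 then 1 else 0

/-- Mean of the route costs, `μφ = (Λ μ̄ + b) D`. -/
def meanCost (μs : E → ℝ) : G.Route → ℝ := (G.Λ *ᵥ P.meanBar μs + G.b) ᵥ* G.D

/-- Covariance of the route costs, `Σφ = Dᵀ (Λ Σ̄ Λᵀ) D`. -/
def covCost : Matrix G.Route G.Route ℝ := G.Dᵀ * (G.Λ * P.covBar * G.Λᵀ) * G.D

/-- The competitors of `r`: the other routes with the same origin-destination pair. -/
abbrev Rival (r : G.Route) : Type _ := {r' : G.Route // r'.1 = r.1 ∧ r' ≠ r}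

/-- The cost comparison matrix `B_rk` of the route `r` (for its own pair `k = r.1`). -/
def B (r : G.Route) : Matrix (G.Rival r) G.Route ℝ :=
  fun j l => if l = r then 1 else if l = j.1 then -1 else 0

/-- `μ_rk = B_rk μφ`. -/
def meanDiff (μs : E → ℝ) (r : G.Route) : G.Rival r → ℝ := G.B r *ᵥ G.meanCost P μs

/-- `Σ_rk = B_rk Σφ B_rkᵀ`. -/
def covDiff (r : G.Route) : Matrix (G.Rival r) (G.Rival r) ℝ :=
  G.B r * G.covCost P * (G.B r)ᵀ

/-- The matrix `[cdf(0; μ_rk, Σ_rk)]` of route choice probabilities; a route is never chosen by an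
agent with another origin-destination pair. -/
def cdfMatrix (μs : E → ℝ) : Matrix G.Route G.OD ℝ :=
  fun r k => if r.1 = k then normalCdf 0 (G.meanDiff P μs r) (G.covDiff P r) else 0

/-- The map `g(μs) = D [cdf(0; μ_rk, Σ_rk)] n`. -/
def g (μs : E → ℝ) : E → ℝ := G.D *ᵥ (G.cdfMatrix P μs *ᵥ G.numAgents)

/-- The probability that, with route costs `φ ∼ N(μφ, Σφ)`, the route `r` costs no more than any
other route with the same pair. -/
def choiceProb (μs : E → ℝ) (r : G.Route) : ℝ :=
  (gaussianLaw (G.meanCost P μs) (G.covCost P)).real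
    {φ | ∀ r' : G.Route, r'.1 = r.1 → φ r ≤ φ r'}

/-- The outcome edge flow `f̂ = D ĥ` with `ĥ_r = n_k p_rk`, in response to the signal `N(μs, Σs)`. -/
def outcomeFlow (μs : E → ℝ) : E → ℝ :=
  G.D *ᵥ fun r => G.numAgents r.1 * G.choiceProb P μs r

/-- The signal `N(μs, Σs)` is self-fulfilling: it is distributed as the sender commits to,
conditionally on the outcome flow that it induces. -/
def IsSelfFulfilling (μs : E → ℝ) : Prop :=
  P.signalLaw μs = P.commitment (G.outcomeFlow P μs)

/-- The nonnegative edge flows. -/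
def nonnegFlows (E : Type*) : Set (E → ℝ) := {f | ∀ e, 0 ≤ f e}

/-- The edge flows `f = D h` with `h` in the box `0 ≤ h_r ≤ n_k` of route flows. -/
def boxFlows : Set (E → ℝ) :=
  (fun h => G.D *ᵥ h) '' {h : G.Route → ℝ | ∀ r, 0 ≤ h r ∧ h r ≤ G.numAgents r.1}

end CongestionGame

end

/-! Choice probabilities lie in [0, 1], so `g` sends every mean to some `D h` with `h` in the box;
both invariance claims follow at once. For existence, the continuous bounded map `h ↦ routeFlow (D
h)` on route flows has a fixed point by Brouwer, and `D h` is then fixed by `g`. Self-fulfilment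
follows because the cdf entries are the choice probabilities (`normalCdf_eq_choiceProb`), so the
outcome flow equals `g`.

The delicate point is continuity, since `covDiff` may be singular and a Gaussian cdf can jump along
a degenerate coordinate. As `covBar` is positive definite, a cost difference of zero variance has a
zero coefficient row; its mean then does not depend on `μs`, and no jump occurs
(`continuous_normalCdf`, `continuous_routeProb`).

Brouwer is proved by the Milnor–Rogers volume argument: under a C¹ retraction `f` onto the sphere,
the volume integral of `id + t (f - id)` is polynomial in `t`, equals the volume of the ball for
small `t > 0`, and vanishes at `t = 1`. -/

/-! ### Brouwer's fixed point theorem -/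

section Brouwer

open Metric Set Filter
open scoped NNReal Topology

variable {E : Type*} [NormedAddCommGroup E] [InnerProductSpace ℝ E] [FiniteDimensional ℝ E]

/-- A small perturbation of the identity that fixes the unit sphere and preserves the open unit
ball maps the open unit ball onto itself. -/
theorem ApproximatesLinearOn.image_unit_ball {h : E → E} {c : ℝ≥0} (hc : c < 1)
    (hA : ApproximatesLinearOn h (ContinuousLinearMap.id ℝ E) (closedBall 0 1) c)
    (hmaps : ∀ x ∈ ball (0 : E) 1, h x ∈ ball (0 : E) 1)
    (hid : ∀ x ∈ sphere (0 : E) 1, h x = x) :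
    InjOn h (ball 0 1) ∧ h '' ball 0 1 = ball 0 1 := by
  have hN : Subsingleton E ∨
      c < ‖((ContinuousLinearEquiv.refl ℝ E).symm : E →L[ℝ] E)‖₊⁻¹ := by
    rcases subsingleton_or_nontrivial E with hE | hE
    · exact Or.inl hE
    · right
      have : ‖((ContinuousLinearEquiv.refl ℝ E).symm : E →L[ℝ] E)‖₊ = 1 := by
        rw [ContinuousLinearEquiv.refl_symm, ContinuousLinearEquiv.coe_refl]
        exact NNReal.eq ContinuousLinearMap.norm_id
      rw [this]; simpa using hc
  have hA' : ApproximatesLinearOn h ((ContinuousLinearEquiv.refl ℝ E : E ≃L[ℝ] E) : E →L[ℝ] E)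
    (ball 0 1) c := hA.mono_set ball_subset_closedBall
  refine ⟨hA'.injOn hN, ?_⟩
  have hopen : IsOpen (h '' ball 0 1) :=
    hA'.open_image (ContinuousLinearEquiv.refl ℝ E).toNonlinearRightInverse isOpen_ball hN
  refine Subset.antisymm (image_subset_iff.2 hmaps) ?_
  have h0 : (0 : E) ∈ ball (0 : E) 1 := mem_ball_self one_pos
  -- The open image is also relatively closed in the connected ball: a limit point has a preimage in
  -- the closed ball, and a preimage on the sphere would be the point itself.
  refine (convex_ball (0 : E) 1).isPreconnected.subset_of_closure_inter_subset hopen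
    ⟨h 0, hmaps 0 h0, mem_image_of_mem _ h0⟩ ?_
  rintro y ⟨hy, hyb⟩
  have hK : IsClosed (h '' closedBall 0 1) :=
    ((isCompact_closedBall (0 : E) 1).image_of_continuousOn hA.continuousOn).isClosed
  obtain ⟨x, hx, rfl⟩ := closure_minimal (image_mono ball_subset_closedBall) hK hy
  refine ⟨x, ?_, rfl⟩
  by_contra hxb
  have hxs : x ∈ sphere (0 : E) 1 := by
    simp only [mem_ball_zero_iff, mem_closedBall_zero_iff, mem_sphere_zero_iff_norm] at *
    linarith
  rw [hid x hxs] at hyb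
  exact hxb hyb

/-- The determinant of `1 + t A` is a polynomial in `t`, so its value at `1` is a fixed affine
combination of its values at any sufficiently many nodes. -/
theorem ContinuousLinearMap.det_id_add_eq_sum (A : E →L[ℝ] E) (s : Finset ℝ)
    (hs : Module.finrank ℝ E < s.card) :
    (ContinuousLinearMap.id ℝ E + A).det =
      ∑ t ∈ s, (Lagrange.basis s id t).eval 1 * (ContinuousLinearMap.id ℝ E + t • A).det := by
  classical
  let b := Module.finBasis ℝ E
  let M := LinearMap.toMatrix b b (A : E →ₗ[ℝ] E)
  let p : Polynomial ℝ := Matrix.det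
    ((Polynomial.X : Polynomial ℝ) • M.map Polynomial.C + (1 : Matrix _ _ ℝ).map Polynomial.C)
  have hp (t : ℝ) : p.eval t = (ContinuousLinearMap.id ℝ E + t • A).det := by
    rw [ContinuousLinearMap.det, ← LinearMap.det_toMatrix b, ← Polynomial.coe_evalRingHom,
      RingHom.map_det]
    congr 1
    ext i j
    simp [M, Matrix.one_apply, LinearMap.toMatrix_apply, Finsupp.single_apply, eq_comm (a := i),
      add_comm, mul_comm t, apply_ite (Polynomial.eval t)]
  have hdeg : p.degree < s.card := by
    refine lt_of_le_of_lt Polynomial.degree_le_natDegree ?_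
    have := Polynomial.natDegree_det_X_add_C_le M 1
    rw [Fintype.card_fin] at this
    exact_mod_cast lt_of_le_of_lt this hs
  have := Lagrange.eq_interpolate (f := p) (s := s) (v := id) (injOn_id _) hdeg
  have h1 := congrArg (Polynomial.eval 1) this
  rw [hp, one_smul, Lagrange.interpolate_apply, Polynomial.eval_finsetSum] at h1
  rw [h1]
  refine Finset.sum_congr rfl fun t _ => ?_
  simp [hp, mul_comm]

/-- There is no `C¹` retraction of the closed unit ball onto the unit sphere. -/
theorem not_exists_retraction_unit_ball {f : E → E} {f' : E → E →L[ℝ] E}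
    (hf : ∀ x ∈ closedBall (0 : E) 1, HasFDerivAt f (f' x) x)
    (hf' : ContinuousOn f' (closedBall 0 1))
    (hnorm : ∀ x ∈ closedBall (0 : E) 1, ‖f x‖ = 1)
    (hid : ∀ x ∈ sphere (0 : E) 1, f x = x) : False := by
  borelize E
  let μ : Measure E := volume
  let I := ContinuousLinearMap.id ℝ E
  let A : E → E →L[ℝ] E := fun x => f' x - I
  have hA : ContinuousOn A (closedBall 0 1) := hf'.sub continuousOn_const
  obtain ⟨K, hK0, hK⟩ : ∃ K : ℝ, 0 < K ∧ ∀ x ∈ closedBall (0 : E) 1, ‖A x‖ ≤ K := by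
    obtain ⟨K, hK⟩ := (isCompact_closedBall (0 : E) 1).exists_bound_of_continuousOn hA
    exact ⟨max K 1, by positivity, fun x hx => (hK x hx).trans (le_max_left _ _)⟩
  obtain ⟨ε, hε, hdet⟩ : ∃ ε > 0, ∀ B : E →L[ℝ] E, ‖B‖ < ε → 0 < (I + B).det := by
    have hc : ContinuousAt (fun B : E →L[ℝ] E => (I + B).det) 0 :=
      (ContinuousLinearMap.continuous_det.comp (continuous_const.add continuous_id)).continuousAt
    have h0 : (0 : ℝ) < (I + 0).det := by
      rw [add_zero]; simp [I, ContinuousLinearMap.det]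
    obtain ⟨ε, hε, h⟩ := Metric.eventually_nhds_iff.1 (hc.eventually (lt_mem_nhds h0))
    exact ⟨ε, hε, fun B hB => h (by simpa using hB)⟩
  have hdetc (t : ℝ) : ContinuousOn (fun x => (I + t • A x).det) (closedBall 0 1) :=
    ContinuousLinearMap.continuous_det.comp_continuousOn
      (continuousOn_const.add (hA.const_smul t))
  have hint (t : ℝ) : IntegrableOn (fun x => (I + t • A x).det) (ball 0 1) μ :=
    ((hdetc t).integrableOn_compact (isCompact_closedBall 0 1)).mono_set ball_subset_closedBall
  have hfd (t : ℝ) (x : E) (hx : x ∈ closedBall (0 : E) 1) :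
      HasFDerivAt (fun x => x + t • (f x - x)) (I + t • A x) x :=
    (hasFDerivAt_id x).add (((hf x hx).sub (hasFDerivAt_id x)).const_smul t)
  -- For small `t` the perturbed map is a bijection of the ball with positive Jacobian, so change of
  -- variables gives the volume.
  have key (t : ℝ) (ht0 : 0 < t) (ht1 : t * K < 1) (ht2 : t * K < ε) (ht3 : t < 1) :
      ∫ x in ball 0 1, (I + t • A x).det ∂μ = μ.real (ball 0 1) := by
    have hb (x : E) (hx : x ∈ closedBall (0 : E) 1) : ‖t • A x‖ ≤ t * K := by
      rw [norm_smul, Real.norm_of_nonneg ht0.le]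
      exact mul_le_mul_of_nonneg_left (hK x hx) ht0.le
    let c : ℝ≥0 := ⟨t * K, by positivity⟩
    have happ : ApproximatesLinearOn (fun x => x + t • (f x - x)) I (closedBall 0 1) c := by
      refine LipschitzOnWith.approximatesLinearOn ?_
      refine Convex.lipschitzOnWith_of_nnnorm_hasFDerivWithin_le (f' := fun x => t • A x)
        (fun x hx => ?_) (fun x hx => hb x hx) (convex_closedBall _ _)
      have := ((hfd t x hx).sub I.hasFDerivAt).hasFDerivWithinAt (s := closedBall 0 1)
      rwa [add_sub_cancel_left] at this
    have hmaps (x : E) (hx : x ∈ ball (0 : E) 1) : x + t • (f x - x) ∈ ball (0 : E) 1 := by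
      have h1 := hnorm x (ball_subset_closedBall hx)
      rw [mem_ball_zero_iff] at hx ⊢
      calc ‖x + t • (f x - x)‖ = ‖(1 - t) • x + t • f x‖ := by congr 1; module
        _ ≤ (1 - t) * ‖x‖ + t * ‖f x‖ := by
          refine (norm_add_le _ _).trans_eq ?_
          rw [norm_smul, norm_smul, Real.norm_of_nonneg ht0.le,
            Real.norm_of_nonneg (sub_nonneg.2 ht3.le)]
        _ < 1 := by rw [h1]; nlinarith
    obtain ⟨hinj, himg⟩ := happ.image_unit_ball (by exact_mod_cast ht1) hmaps
      (fun x hx => by simp [hid x hx])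
    have := integral_image_eq_integral_abs_det_fderiv_smul μ measurableSet_ball
      (fun x hx => (hfd t x (ball_subset_closedBall hx)).hasFDerivWithinAt) hinj
        (fun _ => (1 : ℝ))
    rw [himg] at this
    simp only [integral_const, smul_eq_mul, mul_one, MeasurableSet.univ,
      measureReal_restrict_apply, univ_inter] at this
    rw [this]
    refine setIntegral_congr_fun measurableSet_ball fun x hx => ?_
    exact (abs_of_pos (hdet _ ((hb x (ball_subset_closedBall hx)).trans_lt ht2))).symm
  obtain ⟨δ, hδ0, hδ⟩ : ∃ δ > 0, ∀ t, 0 < t → t < δ → t * K < 1 ∧ t * K < ε ∧ t < 1 := by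
    refine ⟨min (min (1 / K) (ε / K)) 1, by positivity, fun t _ ht => ?_⟩
    simp only [lt_min_iff, lt_div_iff₀ hK0] at ht
    exact ⟨ht.1.1, ht.1.2, ht.2⟩
  obtain ⟨s, hsI, hs⟩ := (Ioo_infinite hδ0).exists_subset_card_eq (Module.finrank ℝ E + 1)
  have hvol : 0 < μ.real (ball (0 : E) 1) :=
    ENNReal.toReal_pos (measure_ball_pos μ 0 one_pos).ne' measure_ball_lt_top.ne
  -- Extrapolation from the small nodes to `t = 1`: the integral is the same at every node and the
  -- Lagrange weights sum to 1.
  have hone : ∫ x in ball 0 1, (I + A x).det ∂μ = μ.real (ball 0 1) := by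
    simp_rw [I, fun x => (A x).det_id_add_eq_sum s (by omega)]
    rw [integral_finsetSum _ fun t _ => (hint t).const_mul _]
    simp_rw [integral_const_mul]
    rw [Finset.sum_congr rfl fun t ht => by
      obtain ⟨h1, h2, h3⟩ := hδ t (hsI ht).1 (hsI ht).2
      rw [key t (hsI ht).1 h1 h2 h3], ← Finset.sum_mul, ← Polynomial.eval_finsetSum,
      Lagrange.sum_basis (injOn_id _) (Finset.card_pos.1 (by omega))]
    simp
  -- Since `‖f‖ = 1`, the range of `f' x` is orthogonal to `f x ≠ 0`, so `f' x` is singular.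
  have hzero : ∫ x in ball 0 1, (I + A x).det ∂μ = 0 := by
    refine setIntegral_eq_zero_of_forall_eq_zero fun x hx => ?_
    have hx' := ball_subset_closedBall hx
    simp only [A, add_sub_cancel]
    by_contra hne
    have hsurj : Function.Surjective (f' x) :=
      ((LinearMap.isUnit_iff_range_eq_top _).1
        ((LinearMap.isUnit_iff_isUnit_det _).2 (isUnit_iff_ne_zero.2 hne)) |>
          LinearMap.range_eq_top.1)
    have hder : HasFDerivAt (fun y => ‖f y‖ ^ 2) (2 • (innerSL ℝ (f x)).comp (f' x)) x :=
      (hf x hx').norm_sq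
    have hcst : HasFDerivAt (fun y => ‖f y‖ ^ 2) (0 : E →L[ℝ] ℝ) x := by
      refine (hasFDerivAt_const (1 : ℝ) x).congr_of_eventuallyEq ?_
      filter_upwards [isOpen_ball.mem_nhds hx] with y hy
      rw [hnorm y (ball_subset_closedBall hy), one_pow]
    obtain ⟨v, hv⟩ := hsurj (f x)
    have := congrArg (fun L : E →L[ℝ] ℝ => L v) (hder.unique hcst)
    simp [hv, hnorm x hx'] at this
  linarith

/-- Brouwer's fixed point theorem for continuously differentiable maps. -/
theorem exists_fixedPoint_unit_closedBall_of_contDiff {F : E → E} (hF : ContDiff ℝ 1 F)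
    (hmaps : MapsTo F (closedBall 0 1) (closedBall 0 1)) :
    ∃ x ∈ closedBall (0 : E) 1, F x = x := by
  by_contra! hne
  let u : E → E := fun x => x - F x
  let a : E → ℝ := fun x => ‖u x‖ ^ 2
  let p : E → ℝ := fun x => inner ℝ x (u x)
  let d : E → ℝ := fun x => p x ^ 2 + a x * (1 - ‖x‖ ^ 2)
  -- The larger root of `‖x + l • u x‖² = 1`: `f x` is where the ray from `F x` through `x` meets
  -- the sphere.
  let l : E → ℝ := fun x => (√(d x) - p x) / a x
  let f : E → E := fun x => x + l x • u x
  have hu : ContDiff ℝ 1 u := contDiff_id.sub hF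
  have ha : ContDiff ℝ 1 a := hu.norm_sq ℝ
  have hp : ContDiff ℝ 1 p := contDiff_id.inner ℝ hu
  have hd : ContDiff ℝ 1 d :=
    (hp.pow 2).add (ha.mul (contDiff_const.sub (contDiff_id.norm_sq ℝ)))
  have ha0 (x : E) (hx : x ∈ closedBall (0 : E) 1) : 0 < a x := by
    have : u x ≠ 0 := sub_ne_zero.2 (hne x hx).symm
    positivity
  have hpos (x : E) (hx : x ∈ sphere (0 : E) 1) : 0 < p x := by
    have hx1 : ‖x‖ = 1 := by simpa using hx
    have hFx : ‖F x‖ ≤ 1 := by simpa using hmaps (sphere_subset_closedBall hx)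
    -- Equality in Cauchy–Schwarz would force `F x = x`.
    have h1 : inner ℝ x (F x) < 1 := by
      refine lt_of_le_of_ne ?_ fun h => hne x (sphere_subset_closedBall hx) ?_
      · calc inner ℝ x (F x) ≤ ‖x‖ * ‖F x‖ := real_inner_le_norm _ _
          _ ≤ 1 := by rw [hx1, one_mul]; exact hFx
      · have hsq : ‖F x - x‖ ^ 2 ≤ 0 := by
          rw [norm_sub_sq_real, real_inner_comm, h, hx1]
          nlinarith [norm_nonneg (F x)]
        have : ‖F x - x‖ = 0 := by nlinarith [norm_nonneg (F x - x)]
        exact sub_eq_zero.1 (norm_eq_zero.1 this)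
    simp only [p, u, inner_sub_right, real_inner_self_eq_norm_sq, hx1]
    linarith
  have hd0 (x : E) (hx : x ∈ closedBall (0 : E) 1) : 0 < d x := by
    by_cases hxs : x ∈ sphere (0 : E) 1
    · have hx1 : ‖x‖ = 1 := by simpa using hxs
      have := hpos x hxs
      simp only [d, hx1]
      nlinarith
    · have hx1 : ‖x‖ < 1 := by
        simp only [mem_closedBall_zero_iff, mem_sphere_zero_iff_norm] at hx hxs
        exact lt_of_le_of_ne hx hxs
      have h1 : 0 < 1 - ‖x‖ ^ 2 := by nlinarith [norm_nonneg x]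
      have := mul_pos (ha0 x hx) h1
      simp only [d]
      nlinarith [sq_nonneg (p x)]
  let U : Set E := {x | 0 < a x} ∩ {x | 0 < d x}
  have hU : IsOpen U := (isOpen_lt continuous_const ha.continuous).inter
    (isOpen_lt continuous_const hd.continuous)
  have hBU : closedBall (0 : E) 1 ⊆ U := fun x hx => ⟨ha0 x hx, hd0 x hx⟩
  have hl : ContDiffOn ℝ 1 l U :=
    ((hd.contDiffOn.sqrt fun x hx => hx.2.ne').sub hp.contDiffOn).div ha.contDiffOn
      fun x hx => hx.1.ne'
  have hf : ContDiffOn ℝ 1 f U := contDiffOn_id.add (hl.smul hu.contDiffOn)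
  refine not_exists_retraction_unit_ball (f := f) (f' := fderiv ℝ f) (fun x hx => ?_)
    ((hf.continuousOn_fderiv_of_isOpen hU le_rfl).mono hBU) (fun x hx => ?_) (fun x hx => ?_)
  · exact ((hf.differentiableOn one_ne_zero).differentiableAt
      (hU.mem_nhds (hBU hx))).hasFDerivAt
  · have ha1 := (ha0 x hx).ne'
    have hsq : ‖f x‖ ^ 2 = 1 := by
      have h1 : ‖f x‖ ^ 2 = ‖x‖ ^ 2 + 2 * (l x * p x) + l x ^ 2 * a x := by
        simp only [f, norm_add_sq_real, real_inner_smul_right, norm_smul, mul_pow, p, a,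
          Real.norm_eq_abs, sq_abs]
      have h2 : l x * a x = √(d x) - p x := div_mul_cancel₀ _ ha1
      have h3 : √(d x) ^ 2 = p x ^ 2 + a x * (1 - ‖x‖ ^ 2) := Real.sq_sqrt (hd0 x hx).le
      have h4 : a x * ‖f x‖ ^ 2 = a x * 1 := by
        rw [h1]
        linear_combination (l x * a x + √(d x) + p x) * h2 + h3
      exact mul_left_cancel₀ ha1 h4
    nlinarith [norm_nonneg (f x)]
  · have hx1 : ‖x‖ = 1 := by simpa using hx
    have : √(d x) = p x := by
      simp only [d, hx1]
      rw [one_pow, sub_self, mul_zero, add_zero, Real.sqrt_sq (hpos x hx).le]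
    simp [f, l, this]

/-- Brouwer's fixed point theorem for the closed unit ball. -/
theorem exists_fixedPoint_unit_closedBall_of_continuous {F : E → E} (hF : Continuous F)
    (hmaps : MapsTo F (closedBall 0 1) (closedBall 0 1)) :
    ∃ x ∈ closedBall (0 : E) 1, F x = x := by
  by_contra! hne
  obtain ⟨z, hz, hmin⟩ := (isCompact_closedBall (0 : E) 1).exists_isMinOn
    ⟨0, mem_closedBall_self zero_le_one⟩ (hF.sub continuous_id).norm.continuousOn
  let δ := ‖F z - z‖
  have hδ : 0 < δ := norm_pos_iff.2 (sub_ne_zero.2 (hne z hz))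
  -- With `δ` the least displacement of `F` on the ball, a C¹ approximation within `δ / 2`, shrunk
  -- back into the ball, has a fixed point that `F` moves by less than `δ`.
  obtain ⟨P, hP, hPF, -⟩ := hF.exists_contDiff_approx 1 (ε := fun _ => δ / 2) continuous_const
    fun _ => half_pos hδ
  let r := (1 + δ / 2)⁻¹
  have hr : 0 < r := by positivity
  have hr1 : r * (1 + δ / 2) = 1 := inv_mul_cancel₀ (by positivity)
  have hnorm (x : E) (hx : x ∈ closedBall (0 : E) 1) : ‖P x‖ ≤ 1 + δ / 2 := by
    have h1 : ‖F x‖ ≤ 1 := by simpa using hmaps hx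
    have h2 := (hPF x).le
    rw [dist_eq_norm] at h2
    calc ‖P x‖ = ‖F x + (P x - F x)‖ := by congr 1; abel
      _ ≤ 1 + δ / 2 := (norm_add_le _ _).trans (add_le_add h1 h2)
  obtain ⟨x, hx, hfix⟩ := exists_fixedPoint_unit_closedBall_of_contDiff
    (F := fun x => r • P x) (hP.const_smul r) (fun x hx => by
      rw [mem_closedBall_zero_iff, norm_smul, Real.norm_of_nonneg hr.le, ← hr1]
      exact mul_le_mul_of_nonneg_left (hnorm x hx) hr.le)
  have hPx : P x = (1 + δ / 2) • x := by
    conv_rhs => rw [← hfix]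
    rw [smul_smul, mul_comm, hr1, one_smul]
  have h1 : ‖P x - x‖ ≤ δ / 2 := by
    rw [hPx, add_smul, one_smul, add_sub_cancel_left, norm_smul,
      Real.norm_of_nonneg (by positivity)]
    exact mul_le_of_le_one_right (by positivity) (by simpa using hx)
  have h2 : ‖F x - P x‖ < δ / 2 := by
    rw [← dist_eq_norm, dist_comm]; exact hPF x
  have h3 : δ ≤ ‖F x - x‖ := hmin hx
  have h4 : ‖F x - x‖ ≤ ‖F x - P x‖ + ‖P x - x‖ := norm_sub_le_norm_sub_add_norm_sub _ _ _
  linarith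

/-- A bounded continuous self-map of a finite-dimensional space has a fixed point. -/
theorem exists_fixedPoint_of_bounded {F : E → E} (hF : Continuous F) {R : ℝ}
    (hR : ∀ x, ‖F x‖ ≤ R) : ∃ x, F x = x := by
  let r := max R 1
  have hr : 0 < r := lt_max_of_lt_right one_pos
  obtain ⟨x, -, hx⟩ := exists_fixedPoint_unit_closedBall_of_continuous
    (F := fun x => r⁻¹ • F (r • x)) (by fun_prop) (fun x _ => by
      rw [mem_closedBall_zero_iff, norm_smul, Real.norm_of_nonneg (by positivity),
        inv_mul_le_iff₀ hr, mul_one]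
      exact (hR _).trans (le_max_left _ _))
  refine ⟨r • x, ?_⟩
  conv_rhs => rw [← hx]
  rw [smul_smul, mul_inv_cancel₀ hr.ne', one_smul]

/-- A bounded continuous self-map of `ι → ℝ`, with `ι` finite, has a fixed point. -/
theorem exists_fixedPoint_pi_of_bounded {ι : Type*} [Fintype ι]
    {F : (ι → ℝ) → ι → ℝ} (hF : Continuous F) {R : ℝ} (hR : ∀ x, ‖F x‖ ≤ R) :
    ∃ x, F x = x := by
  let e := (EuclideanSpace.equiv ι ℝ)
  obtain ⟨x, hx⟩ := exists_fixedPoint_of_bounded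
    (F := fun x => e.symm (F (e x))) (by fun_prop)
    (R := ‖(e.symm : (ι → ℝ) →L[ℝ] EuclideanSpace ℝ ι)‖ * R)
    (fun x => ((e.symm : (ι → ℝ) →L[ℝ] EuclideanSpace ℝ ι).le_opNorm _).trans
      (mul_le_mul_of_nonneg_left (hR _) (norm_nonneg _)))
  exact ⟨e x, by conv_rhs => rw [← hx, e.apply_symm_apply]⟩

end Brouwer

/-! ### Gaussian laws with possibly singular covariance -/

section Gaussian

open Filter
open scoped Topology

variable {ι κ : Type*} [Fintype ι] [DecidableEq ι] [Fintype κ] [DecidableEq κ]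

instance isProbabilityMeasure_gaussianLaw (μ : ι → ℝ) (S : Matrix ι ι ℝ) :
    IsProbabilityMeasure (gaussianLaw μ S) := by
  unfold gaussianLaw; infer_instance

theorem gaussianLaw_eq_map_add (μ : ι → ℝ) (S : Matrix ι ι ℝ) :
    gaussianLaw μ S = (gaussianLaw 0 S).map (fun x => WithLp.toLp 2 μ + x) := by
  unfold gaussianLaw multivariateGaussian
  rw [Measure.map_map (by fun_prop) (by fun_prop)]
  congr 1
  ext x
  simp

/-- The image of a Gaussian law under a linear map. -/
theorem gaussianLaw_map_mulVec (A : Matrix κ ι ℝ) (μ : ι → ℝ) {S : Matrix ι ι ℝ}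
    (hS : S.PosSemidef) :
    (gaussianLaw μ S).map (fun x => WithLp.toLp 2 (A *ᵥ x.ofLp)) =
      gaussianLaw (A *ᵥ μ) (A * S * Aᵀ) := by
  have hS' : (A * S * Aᵀ).PosSemidef := by
    simpa using hS.mul_mul_conjTranspose_same A
  have hm : Measurable fun x : EuclideanSpace ℝ ι => WithLp.toLp 2 (A *ᵥ x.ofLp) := by
    refine Continuous.measurable ?_
    fun_prop
  have := Measure.isProbabilityMeasure_map (μ := gaussianLaw μ S) hm.aemeasurable
  refine Measure.ext_of_charFun ?_
  ext t
  have hadj (x : EuclideanSpace ℝ ι) : inner ℝ (WithLp.toLp 2 (A *ᵥ x.ofLp)) t =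
      inner ℝ x (WithLp.toLp 2 (Aᵀ *ᵥ t.ofLp)) := by
    simp only [EuclideanSpace.inner_eq_star_dotProduct, star_trivial]
    rw [Matrix.dotProduct_mulVec, ← Matrix.mulVec_transpose]
  have h1 : charFun ((gaussianLaw μ S).map fun x => WithLp.toLp 2 (A *ᵥ x.ofLp)) t =
      charFun (gaussianLaw μ S) (WithLp.toLp 2 (Aᵀ *ᵥ t.ofLp)) := by
    rw [charFun_apply, charFun_apply, integral_map hm.aemeasurable (by fun_prop)]
    simp only [hadj]
  rw [h1, gaussianLaw, gaussianLaw, charFun_multivariateGaussian hS,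
    charFun_multivariateGaussian hS', real_inner_comm, real_inner_comm (WithLp.toLp 2 (A *ᵥ μ)) t,
    ← hadj]
  congr 4
  simp only [← Matrix.mulVec_mulVec]
  rw [Matrix.dotProduct_mulVec t.ofLp, ← Matrix.mulVec_transpose]

/-- The Gaussian cumulative distribution function depends continuously on the mean, if the mean
is moved only in coordinates of positive variance. -/
theorem continuous_normalCdf {X : Type*} [TopologicalSpace X] [FirstCountableTopology X]
    {S : Matrix ι ι ℝ} (hS : S.PosSemidef) (y : ι → ℝ) {m : X → ι → ℝ} (hm : Continuous m)
    (hconst : ∀ j, S j j = 0 → ∀ u v, m u j = m v j) :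
    Continuous fun u => normalCdf y (m u) S := by
  have hclosed (u : X) : MeasurableSet {x : EuclideanSpace ℝ ι | ∀ j, m u j + x j ≤ y j} := by
    rw [Set.ofPred_forall]
    exact MeasurableSet.iInter fun j => measurableSet_le (by fun_prop) measurable_const
  have heq (u : X) : normalCdf y (m u) S =
      (gaussianLaw 0 S {x | ∀ j, m u j + x j ≤ y j}).toReal := by
    have hmeas : MeasurableSet {x : EuclideanSpace ℝ ι | ∀ j, x j ≤ y j} := by
      rw [Set.ofPred_forall]
      exact MeasurableSet.iInter fun j => measurableSet_le (by fun_prop) measurable_const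
    rw [normalCdf, gaussianLaw_eq_map_add, measureReal_def, Measure.map_apply (by fun_prop) hmeas]
    rfl
  simp_rw [heq]
  rw [continuous_iff_continuousAt]
  intro u
  refine (ENNReal.tendsto_toReal (measure_ne_top _ _)).comp ?_
  refine tendsto_measure_of_ae_tendsto_indicator_of_isFiniteMeasure _ (hclosed u) hclosed ?_
  -- A marginal of positive variance has no atoms, so almost surely these inequalities are strict or
  -- strictly violated, hence stable near `u`; the remaining ones do not change with `u`.
  have hae : ∀ᵐ x ∂gaussianLaw 0 S, ∀ j, S j j ≠ 0 → m u j + x j ≠ y j := by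
    rw [ae_all_iff]
    intro j
    by_cases hj : S j j = 0
    · simp [hj]
    have hpres := measurePreserving_eval_multivariateGaussian (μ := WithLp.toLp 2 (0 : ι → ℝ)) hS
      (i := j)
    have hvar : (S j j).toNNReal ≠ 0 := by
      have := hS.diag_nonneg (i := j)
      simpa using lt_of_le_of_ne this (Ne.symm hj)
    have := nullSingletonClass_gaussianReal (μ := (WithLp.toLp 2 (0 : ι → ℝ)) j) hvar
    have h0 : ∀ᵐ z ∂gaussianReal ((WithLp.toLp 2 (0 : ι → ℝ)) j) (S j j).toNNReal,
        z ≠ y j - m u j := by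
      rw [ae_iff]; simp
    filter_upwards [hpres.quasiMeasurePreserving.ae h0] with x hx _ h
    exact hx (by linarith)
  filter_upwards [hae] with x hx
  have hev (j : ι) : ∀ᶠ v in 𝓝 u, (m v j + x j ≤ y j ↔ m u j + x j ≤ y j) := by
    by_cases hj : S j j = 0
    · exact Eventually.of_forall fun v => by rw [hconst j hj v u]
    have hc : ContinuousAt (fun v => m v j + x j) u := by fun_prop
    rcases lt_or_gt_of_ne (hx j hj) with h | h
    · filter_upwards [hc.eventually (gt_mem_nhds h)] with v hv
      exact ⟨fun _ => h.le, fun _ => hv.le⟩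
    · filter_upwards [hc.eventually (lt_mem_nhds h)] with v hv
      exact ⟨fun h' => absurd h' (not_le.2 hv), fun h' => absurd h' (not_le.2 h)⟩
  filter_upwards [eventually_all.2 hev] with v hv
  exact forall_congr' hv

theorem normalCdf_nonneg (y μ : ι → ℝ) (S : Matrix ι ι ℝ) : 0 ≤ normalCdf y μ S :=
  measureReal_nonneg

theorem normalCdf_le_one (y μ : ι → ℝ) (S : Matrix ι ι ℝ) : normalCdf y μ S ≤ 1 :=
  measureReal_le_one

end Gaussian

/-! ### Route costs, choice probabilities and the fixed point of `g` -/

/-- The posterior covariance supplies strict positivity; the other two summands are congruences `A *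
S * Aᵀ` of positive semidefinite matrices. -/
theorem GaussianParams.posDef_covBar {E : Type*} [Fintype E] [DecidableEq E]
    {P : GaussianParams E} (hS₀ : P.S₀.PosDef) (hSs : P.Ss.PosDef) (hSh : P.Sh.PosSemidef) :
    P.covBar.PosDef := by
  have hpost : P.postCov.PosDef := (hSs.inv.add hS₀.inv).inv
  have hsymm : P.postCovᵀ = P.postCov := by
    rw [← Matrix.conjTranspose_eq_transpose_of_trivial]; exact hpost.isHermitian
  have hsymm' : P.Ss⁻¹ᵀ = P.Ss⁻¹ := by
    rw [← Matrix.conjTranspose_eq_transpose_of_trivial]; exact hSs.inv.isHermitian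
  have h1 : P.cov₁.PosDef := by
    refine hpost.add_posSemidef ?_
    have := hSs.inv.posSemidef.mul_mul_conjTranspose_same P.postCov
    rw [Matrix.conjTranspose_eq_transpose_of_trivial, hsymm, Matrix.mul_assoc] at this
    rwa [Matrix.transpose_mul, hsymm, hsymm']
  refine h1.add_posSemidef ?_
  have := hSh.mul_mul_conjTranspose_same (P.postCov * P.S₀⁻¹)
  rwa [Matrix.conjTranspose_eq_transpose_of_trivial] at this

namespace CongestionGame

variable {V E N : Type*} [Fintype E] [DecidableEq V] [DecidableEq E]
  (G : CongestionGame V E N) (P : GaussianParams E)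

theorem covDiff_eq (r : G.Route) :
    G.covDiff P r = (G.B r * G.Dᵀ * G.Λ) * P.covBar * (G.B r * G.Dᵀ * G.Λ)ᵀ := by
  simp only [covDiff, covCost, Matrix.transpose_mul, Matrix.transpose_transpose, Matrix.mul_assoc]

theorem meanDiff_eq (μs : E → ℝ) (r : G.Route) :
    G.meanDiff P μs r =
      (G.B r * G.Dᵀ * G.Λ) *ᵥ P.meanBar μs + (G.B r * G.Dᵀ) *ᵥ G.b := by
  rw [meanDiff, meanCost, ← Matrix.mulVec_transpose, Matrix.mulVec_mulVec, Matrix.mulVec_add,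
    Matrix.mulVec_mulVec]

variable {P}

set_option linter.unusedSectionVars false in
theorem posSemidef_covCost (hP : P.covBar.PosDef) : (G.covCost P).PosSemidef := by
  have := hP.posSemidef.mul_mul_conjTranspose_same (G.Dᵀ * G.Λ)
  rw [Matrix.conjTranspose_eq_transpose_of_trivial] at this
  simpa only [covCost, Matrix.transpose_mul, Matrix.transpose_transpose, Matrix.mul_assoc]
    using this

theorem continuous_routeProb (hP : P.covBar.PosDef) (r : G.Route) :
    Continuous fun μs => normalCdf 0 (G.meanDiff P μs r) (G.covDiff P r) := by
  refine continuous_normalCdf ?_ 0 ?_ fun j hj u v => ?_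
  · simpa [covDiff] using (G.posSemidef_covCost hP).mul_mul_conjTranspose_same (G.B r)
  · unfold meanDiff meanCost GaussianParams.meanBar
    fun_prop
  · rw [covDiff_eq] at hj
    -- The variance of coordinate `j` is the quadratic form of `covBar` at this row.
    have hrow : (G.B r * G.Dᵀ * G.Λ) j = 0 := by
      by_contra hne
      have hpos := hP.dotProduct_mulVec_pos hne
      rw [star_trivial] at hpos
      refine hpos.ne' ?_
      rw [← hj]
      generalize G.B r * G.Dᵀ * G.Λ = C
      rw [Matrix.mul_assoc, Matrix.mul_apply]
      rfl
    simp only [meanDiff_eq, Pi.add_apply, Matrix.mulVec, hrow, zero_dotProduct]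

/-- `B r` sends route costs to the differences `φ r - φ r'`, and pushes their Gaussian law to the
one in the cdf. Leaving `r` out of its rivals loses only `φ r ≤ φ r`. -/
theorem normalCdf_eq_choiceProb (hP : P.covBar.PosDef) (μs : E → ℝ) (r : G.Route) :
    normalCdf 0 (G.meanDiff P μs r) (G.covDiff P r) = G.choiceProb P μs r := by
  have hmeas : MeasurableSet
      {x : EuclideanSpace ℝ (G.Rival r) | ∀ j, x j ≤ (0 : G.Rival r → ℝ) j} := by
    rw [Set.ofPred_forall]
    exact MeasurableSet.iInter fun j => measurableSet_le (by fun_prop) measurable_const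
  have hB (x : G.Route → ℝ) (j : G.Rival r) : (G.B r *ᵥ x) j = x r - x j.1 := by
    have hj := j.2.2
    have (l : G.Route) : G.B r j l * x l =
        (if l = r then x l else 0) - (if l = j.1 then x l else 0) := by
      unfold B
      split_ifs with h1 h2 <;> simp_all
    simp [Matrix.mulVec, dotProduct, this, Finset.sum_sub_distrib]
  rw [normalCdf, meanDiff, covDiff, ← gaussianLaw_map_mulVec _ _ (G.posSemidef_covCost hP),
    measureReal_def, Measure.map_apply (Continuous.measurable (by fun_prop)) hmeas, choiceProb,
    measureReal_def]
  congr 2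
  ext x
  simp only [Set.mem_preimage, Set.mem_ofPred_eq, hB, Pi.zero_apply, sub_nonpos, Subtype.forall]
  refine ⟨fun h r' hr' => ?_, fun h r' hr' => h r' hr'.1⟩
  by_cases hr : r' = r
  · rw [hr]
  · exact h r' ⟨hr', hr⟩

variable [Fintype N] (P)

/-- The route flow `h_r = n_k p_rk` in response to the signal `N(μs, Σs)`. -/
noncomputable def routeFlow (μs : E → ℝ) : G.Route → ℝ := fun r =>
  G.numAgents r.1 * normalCdf 0 (G.meanDiff P μs r) (G.covDiff P r)

theorem g_eq (μs : E → ℝ) : G.g P μs = G.D *ᵥ G.routeFlow P μs := by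
  unfold g
  congr 1
  ext r
  simp [routeFlow, cdfMatrix, Matrix.mulVec, dotProduct, mul_comm]

theorem routeFlow_mem_box (μs : E → ℝ) (r : G.Route) :
    0 ≤ G.routeFlow P μs r ∧ G.routeFlow P μs r ≤ G.numAgents r.1 := by
  have hn : 0 ≤ G.numAgents r.1 := Nat.cast_nonneg _
  exact ⟨mul_nonneg hn (normalCdf_nonneg _ _ _),
    mul_le_of_le_one_right hn (normalCdf_le_one _ _ _)⟩

theorem g_mem_boxFlows (μs : E → ℝ) : G.g P μs ∈ G.boxFlows :=
  ⟨G.routeFlow P μs, G.routeFlow_mem_box P μs, (G.g_eq P μs).symm⟩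

set_option linter.unusedSectionVars false in
theorem boxFlows_subset_nonnegFlows : G.boxFlows ⊆ nonnegFlows E := by
  rintro _ ⟨h, hh, rfl⟩ e
  refine Finset.sum_nonneg fun r _ => mul_nonneg ?_ (hh r).1
  simp only [D]
  split_ifs <;> simp

variable {P}

/-- Brouwer is applied in route space, where the box bounds the map on all of `G.Route → ℝ`, so no
invariant set is needed. -/
theorem exists_eq_g (hP : P.covBar.PosDef) : ∃ μs, μs = G.g P μs := by
  obtain ⟨h, hh⟩ := exists_fixedPoint_pi_of_bounded
    (F := fun h : G.Route → ℝ => G.routeFlow P (G.D *ᵥ h))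
    (by
      refine continuous_pi fun r => continuous_const.mul ?_
      exact (G.continuous_routeProb hP r).comp (by fun_prop))
    (R := ∑ r : G.Route, G.numAgents r.1) (fun h => by
      refine (pi_norm_le_iff_of_nonneg
        (Finset.sum_nonneg fun r _ => Nat.cast_nonneg _)).2 fun r => ?_
      obtain ⟨h0, h1⟩ := G.routeFlow_mem_box P (G.D *ᵥ h) r
      rw [Real.norm_of_nonneg h0]
      exact h1.trans (Finset.single_le_sum (f := fun r : G.Route => G.numAgents r.1)
        (fun r _ => Nat.cast_nonneg _) (Finset.mem_univ r)))
  exact ⟨G.D *ᵥ h, by rw [g_eq, hh]⟩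

theorem outcomeFlow_eq_g (hP : P.covBar.PosDef) (μs : E → ℝ) :
    G.outcomeFlow P μs = G.g P μs := by
  rw [g_eq, outcomeFlow]
  simp only [← G.normalCdf_eq_choiceProb hP]
  rfl

end CongestionGame

theorem proposition2 {V E N : Type*} [Fintype E] [DecidableEq V] [DecidableEq E] [Fintype N]
    (G : CongestionGame V E N) (P : GaussianParams E)
    (hS₀ : P.S₀.PosDef) (hSs : P.Ss.PosDef) (hSh : P.Sh.PosSemidef) :
    Set.MapsTo (G.g P) (CongestionGame.nonnegFlows E) (CongestionGame.nonnegFlows E) ∧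
    Set.MapsTo (G.g P) G.boxFlows G.boxFlows ∧
    ∃ μs₀ : E → ℝ, μs₀ ∈ CongestionGame.nonnegFlows E ∧ μs₀ ∈ G.boxFlows ∧
      μs₀ = G.g P μs₀ ∧ G.IsSelfFulfilling P μs₀ := by
  have hP := P.posDef_covBar hS₀ hSs hSh
  obtain ⟨μs, hμs⟩ := G.exists_eq_g hP
  have hbox : μs ∈ G.boxFlows := hμs ▸ G.g_mem_boxFlows P μs
  refine ⟨fun x _ => G.boxFlows_subset_nonnegFlows (G.g_mem_boxFlows P x),
    fun x _ => G.g_mem_boxFlows P x, μs, G.boxFlows_subset_nonnegFlows hbox, hbox, hμs, ?_⟩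
  rw [CongestionGame.IsSelfFulfilling, G.outcomeFlow_eq_g hP, ← hμs]
  rfl
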